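/- **Theorem 4.3 (Hahn's theorem on the $q$-quadratic lattice).** Let $q\in\mathbb C\setminus\{0\}$ not be a root of unity, $(c_1,c_2)\neq(0,0)$, and $x(s)=c_1q^s+c_2q^{-s}+c_3$, $x_k(s)=x(s+\tfrac k2)$, $\Delta f(s)=f(s+1)-f(s)$, $\nabla f(s)=f(s)-f(s-1)$, $\Delta^{(1)}=\Delta/\Delta x(s)$. A sequence of polynomials $(p_n)_{n\ge0}$, $\deg p_n=n$, is an orthogonal polynomial sequence (OPS) with respect to a linear functional $u$ on $\mathbb C[x]$ if $\langle u,p_mp_n\rangle=0$ for $m\ne n$ and $\langle u,p_n^2\rangle\neq0$ for all $n$. It is called *$q$-classical* on the lattice $x(s)$ if, moreover, there are polynomials $\phi$ with $\deg\phi\le2$ and $\psi$ with $\deg\psi=1$ such that, with $\tau(s)=\psi(x(s))$ and $\sigma(s)=\phi(x(s))-\tfrac12\tau(s)\nabla x_1(s)$, the $q$-Pearson equation $\Delta(\sigma u)=\tau u\,\nabla x_1$ holds in the weak sense $$\langle u,\ \phi\,DP+\psi\,SP\rangle=0\quad\text{for every polynomial }P,$$ where $(DP)(x(s))=\frac{P(x_1(s))-P(x_1(s-1))}{\nabla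 x_1(s)}$ and $(SP)(x(s))=\frac{P(x_1(s))+P(x_1(s-1))}{2}$. Let $(p_n)$ be an OPS with respect to $u$. 1. $(p_n)$ is $q$-classical if and only if $(\Delta^{(1)}p_{n+1})_{n\ge0}$, as a sequence of polynomials in $x_1(s)$, is an OPS with respect to some linear functional. 2. Suppose that $u$ is given by a weight, $\langle u,P\rangle=\sum_{s\in\Omega}P(x(s))\rho(s)\nabla x_1(s)$ (unconditionally convergent for every polynomial $P$), where $\Omega=\{a,a+1,\dots,b-1\}$ with $a$ and $b$ possibly infinite (a set $\{s_0+k\}$, $k$ in an interval of $\mathbb Z$). Boundary conditions at an infinite end are understood as limits. (a) If, for some $\phi,\psi$ with $\deg\phi\le 2$, $\deg\psi=1$ and $\sigma,\tau$ as above, $\Delta(\sigma(s)\rho(s))=\tau(s)\rho(s)\nabla x_1(s)$ for all $s\in\Omega$, and $x^k(s)\,x_{-1}^l(s)\,\sigma(s)\rho(s)=0$ at $s=a$ and $s=b$ for all $k,l\ge0$, then $(p_n)$ is $q$-classical and $(\Delta^{(1)}p_{n+1})$ is an OPS. (b) Suppose $x^k(s)\,x_{-1}^l(s)\,\rho(s)=0$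 at $s=a$ and $s=b$ for all $k,l\ge0$, and that $\Omega$ is determinate: a function $R$ on $\Omega$ with $\sum_{s\in\Omega}R(s)x_1(s)^n=0$ for all $n\ge0$ (limits of sums over finite intervals) is zero. Then $(\Delta^{(1)}p_{n+1})$ is an OPS if and only if there are $\phi,\psi$ with $\deg\phi\le2$, $\deg\psi=1$ such that, with $\sigma,\tau$ as above, $\Delta(\sigma(s)\rho(s))=\tau(s)\rho(s)\nabla x_1(s)$ for all $s\in\Omega$. -/

import Mathlib

open Polynomial Filter Topology

noncomputable section

namespace QLattice

/-- The lattice `x(s) = c₁ q^s + c₂ q^(-s) + c₃` (`q^s` is the principal power). -/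
def lattice (q c₁ c₂ c₃ : ℂ) (s : ℂ) : ℂ := c₁ * q ^ s + c₂ * q ^ (-s) + c₃

/-- `(p_n)` is an orthogonal polynomial sequence with respect to the linear functional `u`:
`deg p_n = n` and `⟨u, p_m p_n⟩ = d_n δ_{mn}` with all `d_n ≠ 0`. -/
def IsOPS (u : ℂ[X] →ₗ[ℂ] ℂ) (p : ℕ → ℂ[X]) : Prop :=
  (∀ n, (p n).degree = n) ∧ (∀ m n, m ≠ n → u (p m * p n) = 0) ∧ ∀ n, u (p n * p n) ≠ 0

/-- `d(x₁(s)) = Δ P(x(s)) / Δ x(s)`, where `x₁(s) = x(s + 1/2)`: the polynomial `d` in the variable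
`x₁` is the divided difference `Δ⁽¹⁾ P`. -/
def IsDividedDifference (x : ℂ → ℂ) (P d : ℂ[X]) : Prop :=
  ∀ s, d.eval (x (s + 1 / 2)) * (x (s + 1) - x s) = P.eval (x (s + 1)) - P.eval (x s)

/-- `m(x₁(s)) = (P(x(s + 1)) + P(x(s))) / 2`: the polynomial `m` in the variable `x₁` is the
arithmetic mean of `P`. -/
def IsMean (x : ℂ → ℂ) (P m : ℂ[X]) : Prop :=
  ∀ s, m.eval (x (s + 1 / 2)) = (P.eval (x (s + 1)) + P.eval (x s)) / 2

/-- `(Δ⁽¹⁾ p_{n+1})`, as a sequence of polynomials in `x₁(s)`, is an orthogonal polynomial sequence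
with respect to some linear functional. -/
def DifferencesAreOPS (x : ℂ → ℂ) (p : ℕ → ℂ[X]) : Prop :=
  ∃ d : ℕ → ℂ[X], (∀ n, IsDividedDifference x (p (n + 1)) (d n)) ∧
    ∃ v : ℂ[X] →ₗ[ℂ] ℂ, IsOPS v d

/-- The `q`-Pearson equation `Δ(σ u) = τ u ∇x₁` for a linear functional, in its weak form.
Here `φ = σ + τ ∇x₁ / 2` and `ψ = τ` as polynomials in `x(s)`. Testing the equation against
`P(x₁(s))` and summing by parts gives `⟨u, φ D P + ψ S P⟩ = 0`, where
`D P (x(s)) = (P(x₁(s)) - P(x₁(s - 1))) / ∇x₁(s)` and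
`S P (x(s)) = (P(x₁(s)) + P(x₁(s - 1))) / 2`. -/
def FunctionalPearson (x : ℂ → ℂ) (u : ℂ[X] →ₗ[ℂ] ℂ) (φ ψ : ℂ[X]) : Prop :=
  ∀ P : ℂ[X], ∃ d m : ℂ[X],
    IsDividedDifference x P d ∧ IsMean x P m ∧ u (φ * d + ψ * m) = 0

/-- `(p_n)` is a `q`-classical OPS on the lattice `x` with respect to the functional `u`. -/
def IsQClassicalOPS (x : ℂ → ℂ) (u : ℂ[X] →ₗ[ℂ] ℂ) (p : ℕ → ℂ[X]) : Prop :=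
  IsOPS u p ∧ ∃ φ ψ : ℂ[X], φ.natDegree ≤ 2 ∧ ψ.natDegree = 1 ∧ FunctionalPearson x u φ ψ

/-! ### Functionals given by a weight on the points `s₀ + k`, `k ∈ I` -/

/-- `∇x₁(s) = x(s + 1/2) - x(s - 1/2)`. -/
def nablaX1 (x : ℂ → ℂ) (s : ℂ) : ℂ := x (s + 1 / 2) - x (s - 1 / 2)

/-- `⟨u, P⟩ = ∑ P(x(s)) ρ(s) ∇x₁(s)` over `s = s₀ + k`, `k ∈ I`, for every polynomial `P`. -/
def IsRepresentedBy (x : ℂ → ℂ) (u : ℂ[X] →ₗ[ℂ] ℂ) (s₀ : ℂ) (I : Set ℤ) (ρ : ℂ → ℂ) : Prop :=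
  ∀ P : ℂ[X], HasSum
    (fun k : I => P.eval (x (s₀ + (k : ℤ))) * ρ (s₀ + (k : ℤ)) * nablaX1 x (s₀ + (k : ℤ))) (u P)

/-- The function `σ` with `σ(s) + τ(s) ∇x₁(s) / 2 = φ(x(s))` and `τ(s) = ψ(x(s))`. -/
def sigma (x : ℂ → ℂ) (φ ψ : ℂ[X]) (s : ℂ) : ℂ :=
  φ.eval (x s) - 1 / 2 * ψ.eval (x s) * nablaX1 x s

/-- The pointwise `q`-Pearson equation `Δ(σ(s) ρ(s)) = τ(s) ρ(s) ∇x₁(s)` at `s = s₀ + k`,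
`k ∈ I`. -/
def WeightPearson (x : ℂ → ℂ) (s₀ : ℂ) (I : Set ℤ) (ρ : ℂ → ℂ) (φ ψ : ℂ[X]) : Prop :=
  ∀ k ∈ I, sigma x φ ψ (s₀ + (k : ℤ) + 1) * ρ (s₀ + (k : ℤ) + 1)
      - sigma x φ ψ (s₀ + (k : ℤ)) * ρ (s₀ + (k : ℤ))
    = ψ.eval (x (s₀ + (k : ℤ))) * ρ (s₀ + (k : ℤ)) * nablaX1 x (s₀ + (k : ℤ))

/-- `F` vanishes at both ends `a`, `b` of the interval of integers `I = {k | a ≤ k < b}`, in the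
sense of a limit at an infinite end. -/
def VanishesAtEnds (I : Set ℤ) (F : ℤ → ℂ) : Prop :=
  (∀ a, IsLeast I a → F a = 0) ∧ (∀ c, IsGreatest I c → F (c + 1) = 0) ∧
    (¬ BddBelow I → Tendsto F atBot (𝓝 0)) ∧ (¬ BddAbove I → Tendsto F atTop (𝓝 0))

/-- The boundary conditions `x(s)^i x₋₁(s)^j f(s) = 0` at the ends, for all `i, j ≥ 0`, where
`x₋₁(s) = x(s - 1/2)`. -/
def BoundaryCondition (x : ℂ → ℂ) (s₀ : ℂ) (I : Set ℤ) (f : ℂ → ℂ) : Prop :=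
  ∀ i j : ℕ, VanishesAtEnds I fun k =>
    x (s₀ + (k : ℤ)) ^ i * x (s₀ + (k : ℤ) - 1 / 2) ^ j * f (s₀ + (k : ℤ))

/-- Polynomials in `x₁(s)` determine the functions on `{s₀ + k | k ∈ I}`: a function all of whose
moments (possibly conditionally convergent sums) are zero is zero. -/
def IsDeterminate (x : ℂ → ℂ) (s₀ : ℂ) (I : Set ℤ) : Prop :=
  ∀ R : ℤ → ℂ, (∀ k, k ∉ I → R k = 0) →
    (∀ n : ℕ, Tendsto
      (fun N : ℤ × ℤ => ∑ k ∈ Finset.Ico N.1 N.2, R k * x (s₀ + (k : ℤ) + 1 / 2) ^ n)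
      (atBot ×ˢ atTop) (𝓝 0)) →
    ∀ k, R k = 0

end QLattice

end

noncomputable section

namespace QLattice

/-! ### Quadratic lattices -/

/-! Write `α = (r + r⁻¹)/2`, `S` for the mean, `D` for the divided difference, `L = φ D + ψ S`. On
the lattice, `S` and `D` are operators on polynomials with product rules `D(fg) = Df·Sg + Sf·Dg`,
`S(fg) = Sf·Sg + U₂·Df·Dg` and commutation rules `DS = α SD + U₁ D²`, `S² = 1 + U₁ SD + α U₂ D²`.
Everything in part 1 is algebra with these four rules and leading coefficients.

Pearson implies orthogonality: the rules give `shiftOp (Df·Q) + f·LQ = L(Sf·Q)`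
(`shiftOp_diffOp_mul`). If `u` kills the range of `L`, then `v = u ∘ shiftOp` satisfies `v(Df·Q) =
-u(f·LQ)`. As `L` raises degrees by at most one, orthogonality of `p` gives that of `D p_{n+1}`. The
norms are nonzero once the leading coefficients of `L` are, and `admissible` derives this from the
regularity of `u`.

Orthogonality implies Pearson (`exists_pearson`): if the `D p_{n+1}` are orthogonal for `v`, then `f
↦ v(Df)` and `f ↦ v(X·Df)` vanish on `p_n` for `n > 1` and `n > 2`. Hence they are `u(η·)` and
`u(χ·)` with `deg η ≤ 1`, `deg χ ≤ 2`, and the rule for `DS` becomes the Pearson equation with `φ =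
η·SX - χ`, `ψ = -η`.

For weights, summation by parts (`tendsto_sum_pearson_defect`) identifies the moments of the defect
of the pointwise equation with `-u(LP)`. Its vanishing gives the functional equation, and
determinacy gives the converse. -/

/-- The properties of the lattice `x(s)` on which the theory depends: `r` is a square root of `q`,
and `ω = 4 c₁ c₂`. -/
structure IsQuadraticLattice (x : ℂ → ℂ) (r c ω : ℂ) : Prop where
  ne_zero : r ≠ 0
  pow_ne_one : ∀ n : ℕ, 1 ≤ n → r ^ (2 * n) ≠ 1
  add_shift : ∀ s, x (s + 1 / 2) + x (s - 1 / 2) = 2 * ((r + r⁻¹) / 2 * (x s - c) + c)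
  nabla_sq : ∀ s, nablaX1 x s ^ 2 = 4 * ((((r + r⁻¹) / 2) ^ 2 - 1) * ((x s - c) ^ 2 - ω))
  eq_zero : ∀ f : ℂ[X], (∀ s, f.eval (x s) = 0) → f = 0

/-- `(r ^ n + r ^ (-n)) / 2`. -/
def meanCoeff (r : ℂ) (n : ℕ) : ℂ := (r ^ n + r⁻¹ ^ n) / 2

/-- `(r ^ n - r ^ (-n)) / (r - r ^ (-1))`. -/
def diffCoeff (r : ℂ) (n : ℕ) : ℂ := (r ^ n - r⁻¹ ^ n) / (r - r⁻¹)

/-- The polynomial `(α² - 1) (X - c)`. -/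
def polyU₁ (r c : ℂ) : ℂ[X] := C (((r + r⁻¹) / 2) ^ 2 - 1) * (X - C c)

/-- The polynomial `(α² - 1) ((X - c)² - ω)`, which is `(∇x₁ / 2)²`. -/
def polyU₂ (r c ω : ℂ) : ℂ[X] := C (((r + r⁻¹) / 2) ^ 2 - 1) * ((X - C c) ^ 2 - C ω)

/-- The mean of `X`. -/
def meanX (r c : ℂ) : ℂ[X] := C ((r + r⁻¹) / 2) * (X - C c) + C c

/-- The mean and the divided difference of `X ^ n`. -/
def meanDiffPow (r c ω : ℂ) : ℕ → ℂ[X] × ℂ[X]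
  | 0 => (1, 0)
  | n + 1 => ((meanDiffPow r c ω n).1 * meanX r c + polyU₂ r c ω * (meanDiffPow r c ω n).2,
      (meanDiffPow r c ω n).1 + (meanDiffPow r c ω n).2 * meanX r c)

/-- The arithmetic mean as an operator on polynomials. -/
def meanOp (r c ω : ℂ) : ℂ[X] →ₗ[ℂ] ℂ[X] :=
  Polynomial.lsum fun n => LinearMap.toSpanSingleton ℂ ℂ[X] (meanDiffPow r c ω n).1

/-- The divided difference as an operator on polynomials. -/
def diffOp (r c ω : ℂ) : ℂ[X] →ₗ[ℂ] ℂ[X] :=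
  Polynomial.lsum fun n => LinearMap.toSpanSingleton ℂ ℂ[X] (meanDiffPow r c ω n).2

lemma meanOp_monomial (r c ω : ℂ) (n : ℕ) (a : ℂ) :
    meanOp r c ω (monomial n a) = C a * (meanDiffPow r c ω n).1 := by
  simp [meanOp, Polynomial.lsum_apply, Polynomial.sum_monomial_index, smul_eq_C_mul]

lemma diffOp_monomial (r c ω : ℂ) (n : ℕ) (a : ℂ) :
    diffOp r c ω (monomial n a) = C a * (meanDiffPow r c ω n).2 := by
  simp [diffOp, Polynomial.lsum_apply, Polynomial.sum_monomial_index, smul_eq_C_mul]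

lemma meanOp_one (r c ω : ℂ) : meanOp r c ω 1 = 1 := by
  have := meanOp_monomial r c ω 0 1
  simpa [meanDiffPow] using this

lemma diffOp_one (r c ω : ℂ) : diffOp r c ω 1 = 0 := by
  have := diffOp_monomial r c ω 0 1
  simpa [meanDiffPow] using this

lemma meanOp_X (r c ω : ℂ) : meanOp r c ω X = meanX r c := by
  have := meanOp_monomial r c ω 1 1
  simpa [meanDiffPow, monomial_one_one_eq_X] using this

lemma diffOp_X (r c ω : ℂ) : diffOp r c ω X = 1 := by
  have := diffOp_monomial r c ω 1 1
  simpa [meanDiffPow, monomial_one_one_eq_X] using this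

/-! ### Degrees and leading coefficients -/

lemma natDegree_meanX_le (r c : ℂ) : (meanX r c).natDegree ≤ 1 := by
  unfold meanX; compute_degree

lemma coeff_meanX (r c : ℂ) : (meanX r c).coeff 1 = (r + r⁻¹) / 2 := by
  simp [meanX]

lemma natDegree_polyU₁_le (r c : ℂ) : (polyU₁ r c).natDegree ≤ 1 := by
  unfold polyU₁; compute_degree

lemma coeff_polyU₁ (r c : ℂ) : (polyU₁ r c).coeff 1 = ((r + r⁻¹) / 2) ^ 2 - 1 := by
  rw [polyU₁, coeff_C_mul]; simp

lemma natDegree_polyU₂_le (r c ω : ℂ) : (polyU₂ r c ω).natDegree ≤ 2 := by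
  unfold polyU₂; compute_degree

lemma coeff_polyU₂ (r c ω : ℂ) : (polyU₂ r c ω).coeff 2 = ((r + r⁻¹) / 2) ^ 2 - 1 := by
  unfold polyU₂; compute_degree; simp

lemma mul_natDegree_coeff {f g : ℂ[X]} {m n : ℕ} {a b : ℂ} (hf : f.natDegree ≤ m ∧ f.coeff m = a)
    (hg : g.natDegree ≤ n ∧ g.coeff n = b) :
    (f * g).natDegree ≤ m + n ∧ (f * g).coeff (m + n) = a * b :=
  ⟨natDegree_mul_le_of_le hf.1 hg.1, by rw [coeff_mul_add_eq_of_natDegree_le hf.1 hg.1, hf.2, hg.2]⟩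

lemma add_natDegree_coeff {f g : ℂ[X]} {n : ℕ} {a b : ℂ} (hf : f.natDegree ≤ n ∧ f.coeff n = a)
    (hg : g.natDegree ≤ n ∧ g.coeff n = b) :
    (f + g).natDegree ≤ n ∧ (f + g).coeff n = a + b :=
  ⟨natDegree_add_le_of_degree_le hf.1 hg.1, by rw [coeff_add, hf.2, hg.2]⟩

/-- Divided differences lower degrees by one, so their bounds are stated for `X * f`; this avoids `n
- 1` and a separate case for constants. -/
lemma of_X_mul_natDegree_coeff {f : ℂ[X]} {n : ℕ} {a : ℂ}
    (h : (X * f).natDegree ≤ n + 1 ∧ (X * f).coeff (n + 1) = a) :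
    f.natDegree ≤ n ∧ f.coeff n = a := by
  refine ⟨?_, by simpa using h.2⟩
  rcases eq_or_ne f 0 with rfl | hf
  · simp
  · have := h.1
    rw [natDegree_X_mul hf] at this
    omega

lemma X_mul_natDegree_coeff {f : ℂ[X]} {n : ℕ} {a : ℂ}
    (h : f.natDegree ≤ n ∧ f.coeff n = a) :
    (X * f).natDegree ≤ n + 1 ∧ (X * f).coeff (n + 1) = a := by
  have := mul_natDegree_coeff (f := X) (m := 1) (a := 1) ⟨natDegree_X_le, by simp⟩ h
  rwa [add_comm, one_mul] at this

section Coefficients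

variable {r : ℂ}

/-- With `r = e^θ`, `meanCoeff` is `cosh nθ`, `diffCoeff` is `sinh nθ / sinh θ` and `α² - 1 = sinh²
θ`. This and `diffCoeff_succ` are the addition formulas. -/
lemma meanCoeff_succ (h₀ : r ≠ 0) (n : ℕ) :
    meanCoeff r (n + 1) =
      meanCoeff r n * ((r + r⁻¹) / 2) + (((r + r⁻¹) / 2) ^ 2 - 1) * diffCoeff r n := by
  have h : ((r + r⁻¹) / 2) ^ 2 - 1 = (r - r⁻¹) ^ 2 / 4 := by field_simp; ring
  rw [h]
  unfold meanCoeff diffCoeff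
  generalize r⁻¹ = t at *
  field_simp
  ring

lemma diffCoeff_succ (h₁ : r - r⁻¹ ≠ 0) (n : ℕ) :
    diffCoeff r (n + 1) = meanCoeff r n + diffCoeff r n * ((r + r⁻¹) / 2) := by
  unfold meanCoeff diffCoeff
  generalize r⁻¹ = t at *
  field_simp
  ring

/-- The recursion of `meanDiffPow` is the pair of product rules with second factor `X`, where `DX =
1`; on leading coefficients it reduces to the addition formulas. -/
lemma meanDiffPow_natDegree_coeff (h₀ : r ≠ 0) (h₁ : r - r⁻¹ ≠ 0) (c ω : ℂ) (n : ℕ) :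
    ((meanDiffPow r c ω n).1.natDegree ≤ n ∧ (meanDiffPow r c ω n).1.coeff n = meanCoeff r n) ∧
    ((X * (meanDiffPow r c ω n).2).natDegree ≤ n ∧
      (X * (meanDiffPow r c ω n).2).coeff n = diffCoeff r n) := by
  induction n with
  | zero => simp [meanDiffPow, meanCoeff, diffCoeff]
  | succ n ih =>
    obtain ⟨ih₁, ih₂⟩ := ih
    have hM := And.intro (natDegree_meanX_le r c) (coeff_meanX r c)
    have hU := And.intro (natDegree_polyU₂_le r c ω) (coeff_polyU₂ r c ω)
    have h := mul_natDegree_coeff hU ih₂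
    constructor
    · rw [meanCoeff_succ h₀]
      refine add_natDegree_coeff (mul_natDegree_coeff ih₁ hM) (of_X_mul_natDegree_coeff ?_)
      rwa [mul_left_comm, show n + 1 + 1 = 2 + n by ring]
    · rw [diffCoeff_succ h₁]
      simp only [meanDiffPow, mul_add, ← mul_assoc]
      exact add_natDegree_coeff (X_mul_natDegree_coeff ih₁) (mul_natDegree_coeff ih₂ hM)

lemma linear_natDegree_coeff (T : ℂ[X] →ₗ[ℂ] ℂ[X]) (t : ℕ → ℂ)
    (hT : ∀ n, (T (monomial n 1)).natDegree ≤ n ∧ (T (monomial n 1)).coeff n = t n)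
    {P : ℂ[X]} {n : ℕ} (hP : P.natDegree ≤ n) :
    (T P).natDegree ≤ n ∧ (T P).coeff n = t n * P.coeff n := by
  have hsum : T P = ∑ i ∈ Finset.range (n + 1), C (P.coeff i) * T (monomial i 1) := by
    conv_lhs => rw [P.as_sum_range' (n + 1) (by omega), map_sum]
    refine Finset.sum_congr rfl fun i _ => ?_
    rw [← smul_eq_C_mul, ← map_smul, smul_monomial, smul_eq_mul, mul_one]
  have hlow : ∀ i ∈ Finset.range (n + 1), (C (P.coeff i) * T (monomial i 1)).natDegree ≤ i :=
    fun i _ => (natDegree_C_mul_le _ _).trans (hT i).1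
  constructor
  · rw [hsum]
    refine natDegree_sum_le_of_forall_le _ _ fun i hi => (hlow i hi).trans ?_
    have := Finset.mem_range.1 hi
    omega
  · rw [hsum, Finset.sum_range_succ, coeff_add, finsetSum_coeff, Finset.sum_eq_zero, zero_add,
      coeff_C_mul, (hT n).2, mul_comm]
    intro i hi
    have := Finset.mem_range.1 hi
    exact coeff_eq_zero_of_natDegree_lt ((hlow i (Finset.mem_range.2 (by omega))).trans_lt this)

lemma meanOp_natDegree_coeff (h₀ : r ≠ 0) (h₁ : r - r⁻¹ ≠ 0) (c ω : ℂ) {P : ℂ[X]} {n : ℕ}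
    (hP : P.natDegree ≤ n) : (meanOp r c ω P).natDegree ≤ n ∧
      (meanOp r c ω P).coeff n = meanCoeff r n * P.coeff n := by
  refine linear_natDegree_coeff _ _ (fun n => ?_) hP
  rw [meanOp_monomial, C_1, one_mul]
  exact (meanDiffPow_natDegree_coeff h₀ h₁ c ω n).1

lemma X_mul_diffOp_natDegree_coeff (h₀ : r ≠ 0) (h₁ : r - r⁻¹ ≠ 0) (c ω : ℂ) {P : ℂ[X]} {n : ℕ}
    (hP : P.natDegree ≤ n) : (X * diffOp r c ω P).natDegree ≤ n ∧
      (X * diffOp r c ω P).coeff n = diffCoeff r n * P.coeff n := by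
  refine linear_natDegree_coeff ((LinearMap.mulLeft ℂ X).comp (diffOp r c ω)) _ (fun n => ?_) hP
  rw [LinearMap.comp_apply, LinearMap.mulLeft_apply, diffOp_monomial, C_1, one_mul]
  exact (meanDiffPow_natDegree_coeff h₀ h₁ c ω n).2

lemma diffOp_natDegree_coeff (h₀ : r ≠ 0) (h₁ : r - r⁻¹ ≠ 0) (c ω : ℂ) {P : ℂ[X]} {n : ℕ}
    (hP : P.natDegree ≤ n + 1) : (diffOp r c ω P).natDegree ≤ n ∧
      (diffOp r c ω P).coeff n = diffCoeff r (n + 1) * P.coeff (n + 1) :=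
  of_X_mul_natDegree_coeff (X_mul_diffOp_natDegree_coeff h₀ h₁ c ω hP)

end Coefficients

lemma meanCoeff_ne_zero {r : ℂ} (h₀ : r ≠ 0) (h : ∀ n : ℕ, 1 ≤ n → r ^ (2 * n) ≠ 1) (n : ℕ) :
    meanCoeff r n ≠ 0 := by
  intro hn
  have h₁ : r ^ n + r⁻¹ ^ n = 0 := by simpa [meanCoeff] using hn
  have h₂ : r ^ n * r⁻¹ ^ n = 1 := by rw [← mul_pow, mul_inv_cancel₀ h₀, one_pow]
  have h₃ : r ^ (2 * n) = -1 := by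
    rw [two_mul, pow_add]; linear_combination r ^ n * h₁ - h₂
  rcases Nat.eq_zero_or_pos n with rfl | hpos
  · norm_num at h₃
  -- Squaring `r ^ (2n) = -1` gives `r ^ (4n) = 1`.
  · exact h (2 * n) (by omega) (by rw [mul_comm 2 (2 * n), pow_mul, h₃]; norm_num)

lemma diffCoeff_succ_ne_zero {r : ℂ} (h₀ : r ≠ 0) (h : ∀ n : ℕ, 1 ≤ n → r ^ (2 * n) ≠ 1)
    (h₁ : r - r⁻¹ ≠ 0) (n : ℕ) : diffCoeff r (n + 1) ≠ 0 := by
  refine div_ne_zero (fun hn => h (n + 1) (by omega) ?_) h₁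
  have h₂ : r ^ (n + 1) * r⁻¹ ^ (n + 1) = 1 := by rw [← mul_pow, mul_inv_cancel₀ h₀, one_pow]
  rw [two_mul, pow_add]
  linear_combination r ^ (n + 1) * hn + h₂

/-! ### Values of the operators on the lattice -/

namespace IsQuadraticLattice

variable {x : ℂ → ℂ} {r c ω : ℂ}

lemma sub_inv_ne_zero (hx : IsQuadraticLattice x r c ω) : r - r⁻¹ ≠ 0 := by
  intro h
  have h₁ : r * r⁻¹ = 1 := mul_inv_cancel₀ hx.ne_zero
  exact hx.pow_ne_one 1 le_rfl (by linear_combination r * h + h₁)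

lemma sq_sub_one_ne_zero (hx : IsQuadraticLattice x r c ω) : ((r + r⁻¹) / 2) ^ 2 - 1 ≠ 0 := by
  have h₀ := hx.ne_zero
  have h : ((r + r⁻¹) / 2) ^ 2 - 1 = (r - r⁻¹) ^ 2 / 4 := by field_simp; ring
  rw [h]
  exact div_ne_zero (pow_ne_zero 2 hx.sub_inv_ne_zero) (by norm_num)

lemma polyU₂_ne_zero (hx : IsQuadraticLattice x r c ω) : polyU₂ r c ω ≠ 0 := by
  intro h
  have := coeff_polyU₂ r c ω
  rw [h, coeff_zero] at this
  exact hx.sq_sub_one_ne_zero this.symm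

lemma eval_polyU₂ (hx : IsQuadraticLattice x r c ω) (s : ℂ) :
    (polyU₂ r c ω).eval (x s) = (nablaX1 x s / 2) ^ 2 := by
  rw [div_pow, hx.nabla_sq]
  simp [polyU₂]
  ring

lemma eval_meanX (hx : IsQuadraticLattice x r c ω) (s : ℂ) :
    (meanX r c).eval (x s) = (x (s + 1 / 2) + x (s - 1 / 2)) / 2 := by
  rw [hx.add_shift]
  simp [meanX]

/-- A polynomial is determined by its values on the lattice, and the factor `∇x₁` cancels. -/
lemma ext_mul_nabla (hx : IsQuadraticLattice x r c ω) {f g : ℂ[X]}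
    (h : ∀ s, f.eval (x s) * nablaX1 x s = g.eval (x s) * nablaX1 x s) : f = g := by
  -- Only the square of `∇x₁(s)` is given as a polynomial in `x(s)`, so the hypothesis is squared.
  have h₁ : (f - g) ^ 2 * polyU₂ r c ω = 0 := hx.eq_zero _ fun s => by
    rw [eval_mul, eval_pow, hx.eval_polyU₂, eval_sub]
    linear_combination
      (f.eval (x s) * nablaX1 x s - g.eval (x s) * nablaX1 x s) / 4 * (h s)
  have h₂ := (mul_eq_zero.1 h₁).resolve_right hx.polyU₂_ne_zero
  exact sub_eq_zero.1 (pow_eq_zero_iff two_ne_zero |>.1 h₂)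

lemma ext (hx : IsQuadraticLattice x r c ω) {f g : ℂ[X]}
    (h : ∀ s, f.eval (x s) = g.eval (x s)) : f = g :=
  hx.ext_mul_nabla fun s => by rw [h]

lemma eval_meanOp_diffOp (hx : IsQuadraticLattice x r c ω) (P : ℂ[X]) (s : ℂ) :
    (meanOp r c ω P).eval (x s) = (P.eval (x (s + 1 / 2)) + P.eval (x (s - 1 / 2))) / 2 ∧
    (diffOp r c ω P).eval (x s) * nablaX1 x s = P.eval (x (s + 1 / 2)) - P.eval (x (s - 1 / 2)) := by
  induction P using Polynomial.induction_on' with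
  | add p q hp hq =>
    simp only [map_add, eval_add, add_mul, hp.1, hp.2, hq.1, hq.2]
    constructor <;> ring
  | monomial n a =>
    have key : (meanDiffPow r c ω n).1.eval (x s) =
          (x (s + 1 / 2) ^ n + x (s - 1 / 2) ^ n) / 2 ∧
        (meanDiffPow r c ω n).2.eval (x s) * nablaX1 x s =
          x (s + 1 / 2) ^ n - x (s - 1 / 2) ^ n := by
      induction n with
      | zero => simp [meanDiffPow]
      | succ n ih =>
        obtain ⟨ih₁, ih₂⟩ := ih
        have hdef : nablaX1 x s = x (s + 1 / 2) - x (s - 1 / 2) := rfl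
        simp only [meanDiffPow, eval_add, eval_mul, hx.eval_polyU₂, hx.eval_meanX, ih₁]
        constructor
        · linear_combination (nablaX1 x s / 4) * ih₂ +
            (x (s + 1 / 2) ^ n - x (s - 1 / 2) ^ n) / 4 * hdef
        · linear_combination (x (s + 1 / 2) + x (s - 1 / 2)) / 2 * ih₂ +
            (x (s + 1 / 2) ^ n + x (s - 1 / 2) ^ n) / 2 * hdef
    rw [meanOp_monomial, diffOp_monomial, eval_mul, eval_mul, eval_C, key.1, mul_assoc, key.2]
    simp only [eval_monomial]
    constructor <;> ring

lemma eval_meanOp (hx : IsQuadraticLattice x r c ω) (P : ℂ[X]) (s : ℂ) :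
    (meanOp r c ω P).eval (x s) = (P.eval (x (s + 1 / 2)) + P.eval (x (s - 1 / 2))) / 2 :=
  (hx.eval_meanOp_diffOp P s).1

lemma eval_diffOp (hx : IsQuadraticLattice x r c ω) (P : ℂ[X]) (s : ℂ) :
    (diffOp r c ω P).eval (x s) * nablaX1 x s =
      P.eval (x (s + 1 / 2)) - P.eval (x (s - 1 / 2)) :=
  (hx.eval_meanOp_diffOp P s).2

lemma isMean_iff (hx : IsQuadraticLattice x r c ω) (P m : ℂ[X]) :
    IsMean x P m ↔ m = meanOp r c ω P := by
  constructor
  · refine fun h => hx.ext fun s => ?_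
    have := h (s - 1 / 2)
    rw [show s - 1 / 2 + 1 / 2 = s by ring, show s - 1 / 2 + 1 = s + 1 / 2 by ring] at this
    rw [hx.eval_meanOp, this]
  · rintro rfl s
    rw [hx.eval_meanOp, show s + 1 / 2 + 1 / 2 = s + 1 by ring, add_sub_cancel_right]

lemma isDividedDifference_iff (hx : IsQuadraticLattice x r c ω) (P d : ℂ[X]) :
    IsDividedDifference x P d ↔ d = diffOp r c ω P := by
  constructor
  · refine fun h => hx.ext_mul_nabla fun s => ?_
    have := h (s - 1 / 2)
    rw [show s - 1 / 2 + 1 / 2 = s by ring, show s - 1 / 2 + 1 = s + 1 / 2 by ring] at this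
    rw [hx.eval_diffOp, ← this, nablaX1]
  · rintro rfl s
    have := hx.eval_diffOp P (s + 1 / 2)
    rwa [nablaX1, show s + 1 / 2 + 1 / 2 = s + 1 by ring, add_sub_cancel_right] at this

/-! ### Identities between the operators -/

lemma diffOp_mul (hx : IsQuadraticLattice x r c ω) (f g : ℂ[X]) :
    diffOp r c ω (f * g) = diffOp r c ω f * meanOp r c ω g + meanOp r c ω f * diffOp r c ω g :=
  hx.ext_mul_nabla fun s => by
    rw [hx.eval_diffOp]
    simp only [eval_add, eval_mul, hx.eval_meanOp]
    linear_combination -(g.eval (x (s + 1 / 2)) + g.eval (x (s - 1 / 2))) / 2 * hx.eval_diffOp f s -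
      (f.eval (x (s + 1 / 2)) + f.eval (x (s - 1 / 2))) / 2 * hx.eval_diffOp g s

lemma meanOp_mul (hx : IsQuadraticLattice x r c ω) (f g : ℂ[X]) :
    meanOp r c ω (f * g) = meanOp r c ω f * meanOp r c ω g +
      polyU₂ r c ω * (diffOp r c ω f * diffOp r c ω g) :=
  hx.ext fun s => by
    simp only [eval_add, eval_mul, hx.eval_meanOp, hx.eval_polyU₂]
    have hf := hx.eval_diffOp f s
    have hg := hx.eval_diffOp g s
    linear_combination -(diffOp r c ω g).eval (x s) * nablaX1 x s / 4 * hf -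
      (f.eval (x (s + 1 / 2)) - f.eval (x (s - 1 / 2))) / 4 * hg

/-- The last factor is `x(s + 1) - x(s)`, by two uses of `add_shift`. Half the sum of the forward
and backward formulas yields the rule for `DS`, a quarter of their difference the rule for `S²`. -/
lemma shift_forward (hx : IsQuadraticLattice x r c ω) (P : ℂ[X]) (s : ℂ) :
    P.eval (x (s + 1)) - P.eval (x s) = (diffOp r c ω P).eval (x (s + 1 / 2)) *
      ((r + r⁻¹) / 2 * nablaX1 x s + 2 * (polyU₁ r c).eval (x s)) := by
  have h := hx.eval_diffOp P (s + 1 / 2)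
  have h₁ := hx.add_shift (s + 1 / 2)
  have h₂ := hx.add_shift s
  rw [nablaX1] at h
  rw [show s + 1 / 2 + 1 / 2 = s + 1 by ring, show s + 1 / 2 - 1 / 2 = s by ring] at h h₁
  rw [← h]
  simp only [polyU₁, nablaX1, eval_mul, eval_C, eval_sub, eval_X]
  linear_combination (diffOp r c ω P).eval (x (s + 1 / 2)) * (h₁ + (r + r⁻¹) / 2 * h₂)

lemma shift_backward (hx : IsQuadraticLattice x r c ω) (P : ℂ[X]) (s : ℂ) :
    P.eval (x s) - P.eval (x (s - 1)) = (diffOp r c ω P).eval (x (s - 1 / 2)) *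
      ((r + r⁻¹) / 2 * nablaX1 x s - 2 * (polyU₁ r c).eval (x s)) := by
  have h := hx.eval_diffOp P (s - 1 / 2)
  have h₁ := hx.add_shift (s - 1 / 2)
  have h₂ := hx.add_shift s
  rw [nablaX1] at h
  rw [show s - 1 / 2 + 1 / 2 = s by ring, show s - 1 / 2 - 1 / 2 = s - 1 by ring] at h h₁
  rw [← h]
  simp only [polyU₁, nablaX1, eval_mul, eval_C, eval_sub, eval_X]
  linear_combination -(diffOp r c ω P).eval (x (s - 1 / 2)) * (h₁ + (r + r⁻¹) / 2 * h₂)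

lemma eval_meanOp_half (hx : IsQuadraticLattice x r c ω) (P : ℂ[X]) (s : ℂ) :
    (meanOp r c ω P).eval (x (s + 1 / 2)) = (P.eval (x (s + 1)) + P.eval (x s)) / 2 ∧
    (meanOp r c ω P).eval (x (s - 1 / 2)) = (P.eval (x s) + P.eval (x (s - 1))) / 2 := by
  rw [hx.eval_meanOp, hx.eval_meanOp, show s + 1 / 2 + 1 / 2 = s + 1 by ring,
    show s - 1 / 2 - 1 / 2 = s - 1 by ring, add_sub_cancel_right, sub_add_cancel]
  exact ⟨rfl, rfl⟩

lemma diffOp_meanOp (hx : IsQuadraticLattice x r c ω) (P : ℂ[X]) :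
    diffOp r c ω (meanOp r c ω P) = C ((r + r⁻¹) / 2) * meanOp r c ω (diffOp r c ω P) +
      polyU₁ r c * diffOp r c ω (diffOp r c ω P) :=
  hx.ext_mul_nabla fun s => by
    rw [hx.eval_diffOp, (hx.eval_meanOp_half P s).1, (hx.eval_meanOp_half P s).2]
    simp only [eval_add, eval_mul, eval_C, hx.eval_meanOp]
    linear_combination (hx.shift_forward P s + hx.shift_backward P s) / 2 -
      (polyU₁ r c).eval (x s) * hx.eval_diffOp (diffOp r c ω P) s

lemma meanOp_meanOp (hx : IsQuadraticLattice x r c ω) (P : ℂ[X]) :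
    meanOp r c ω (meanOp r c ω P) = P + polyU₁ r c * meanOp r c ω (diffOp r c ω P) +
      C ((r + r⁻¹) / 2) * polyU₂ r c ω * diffOp r c ω (diffOp r c ω P) :=
  hx.ext fun s => by
    rw [hx.eval_meanOp, (hx.eval_meanOp_half P s).1, (hx.eval_meanOp_half P s).2]
    simp only [eval_add, eval_mul, eval_C, hx.eval_meanOp, hx.eval_polyU₂]
    linear_combination (hx.shift_forward P s - hx.shift_backward P s) / 4 -
      (r + r⁻¹) / 2 * nablaX1 x s / 4 * hx.eval_diffOp (diffOp r c ω P) s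

lemma meanOp_meanX (hx : IsQuadraticLattice x r c ω) :
    meanOp r c ω (meanX r c) = X + polyU₁ r c := by
  have := hx.meanOp_meanOp X
  simpa [meanOp_X, diffOp_X, meanOp_one, diffOp_one] using this

lemma diffOp_meanX (hx : IsQuadraticLattice x r c ω) :
    diffOp r c ω (meanX r c) = C ((r + r⁻¹) / 2) := by
  have := hx.diffOp_meanOp X
  simpa [meanOp_X, diffOp_X, meanOp_one, diffOp_one] using this

end IsQuadraticLattice

/-! ### The lattice `c₁ q^s + c₂ q^(-s) + c₃` -/

/-- When one coefficient vanishes, the value `w = 0` is not attained. Otherwise `z` is a root of `c₁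
z² - w z + c₂`. -/
lemma exists_ne_zero_root {c₁ c₂ w : ℂ} (hc : c₁ ≠ 0 ∨ c₂ ≠ 0) (hw : w ≠ 0) :
    ∃ z : ℂ, z ≠ 0 ∧ c₁ * z + c₂ * z⁻¹ = w := by
  by_cases h₁ : c₁ = 0
  · have h₂ : c₂ ≠ 0 := hc.resolve_left (not_not.2 h₁)
    exact ⟨c₂ / w, div_ne_zero h₂ hw, by subst h₁; field_simp; simp⟩
  by_cases h₂ : c₂ = 0
  · exact ⟨w / c₁, div_ne_zero hw h₁, by subst h₂; field_simp; simp⟩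
  obtain ⟨t, ht⟩ := IsAlgClosed.exists_eq_mul_self (w ^ 2 - 4 * c₁ * c₂)
  have hz : c₁ * ((w + t) / (2 * c₁)) ^ 2 - w * ((w + t) / (2 * c₁)) + c₂ = 0 := by
    field_simp
    linear_combination -ht
  refine ⟨(w + t) / (2 * c₁), ?_, ?_⟩
  · intro h
    rw [h] at hz
    exact h₂ (by simpa using hz)
  · have hne : (w + t) / (2 * c₁) ≠ 0 := by
      intro h
      rw [h] at hz
      exact h₂ (by simpa using hz)
    generalize (w + t) / (2 * c₁) = z at *
    field_simp
    linear_combination hz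

lemma isQuadraticLattice_lattice {q c₁ c₂ : ℂ} (c₃ : ℂ) (hq₀ : q ≠ 0)
    (hq : ∀ n : ℕ, 1 ≤ n → q ^ n ≠ 1) (hc : c₁ ≠ 0 ∨ c₂ ≠ 0) :
    IsQuadraticLattice (lattice q c₁ c₂ c₃) (q ^ (1 / 2 : ℂ)) c₃ (4 * c₁ * c₂) := by
  set r := q ^ (1 / 2 : ℂ) with hr
  have hr₀ : r ≠ 0 := by simp [hr, Complex.cpow_eq_zero_iff, hq₀]
  have hr₂ : r ^ 2 = q := by
    rw [hr, ← Complex.cpow_nat_mul]; norm_num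
  have hneg : ∀ s : ℂ, q ^ (-s) = (q ^ s)⁻¹ := fun s => Complex.cpow_neg _ _
  have hadd : ∀ s : ℂ, q ^ (s + 1 / 2) = q ^ s * r := fun s => Complex.cpow_add _ _ hq₀
  have hsub : ∀ s : ℂ, q ^ (s - 1 / 2) = q ^ s * r⁻¹ := fun s => by
    rw [Complex.cpow_sub _ _ hq₀, div_eq_mul_inv]
  have hs₀ : ∀ s : ℂ, q ^ s ≠ 0 := fun s => by simp [Complex.cpow_eq_zero_iff, hq₀]
  refine ⟨hr₀, fun n hn => by rw [pow_mul, hr₂]; exact hq n hn, fun s => ?_, fun s => ?_, ?_⟩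
  · simp only [lattice, hneg, hadd, hsub]
    have := hs₀ s
    generalize q ^ s = z at *
    field_simp
    ring
  · simp only [nablaX1, lattice, hneg, hadd, hsub]
    have := hs₀ s
    generalize q ^ s = z at *
    field_simp
    ring
  · intro f hf
    -- The lattice takes every value except possibly `c₃`, since `q ^ s` takes every nonzero value.
    refine Polynomial.eq_zero_of_infinite_isRoot f
      (Set.Infinite.mono (s := {c₃}ᶜ) (fun w hw => ?_) (Set.finite_singleton c₃).infinite_compl)
    obtain ⟨z, hz₀, hz⟩ := exists_ne_zero_root hc (sub_ne_zero.2 hw)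
    have hlog : Complex.log q ≠ 0 := by
      intro h
      have := Complex.exp_log hq₀
      rw [h, Complex.exp_zero] at this
      exact hq 1 le_rfl (by rw [← this, pow_one])
    have hqz : q ^ (Complex.log z / Complex.log q) = z := by
      rw [Complex.cpow_def_of_ne_zero hq₀, mul_div_cancel₀ _ hlog, Complex.exp_log hz₀]
    have := hf (Complex.log z / Complex.log q)
    rw [lattice, hneg, hqz, hz, sub_add_cancel] at this
    exact this

/-! ### Orthogonal polynomial sequences -/

namespace IsOPS

variable {u : ℂ[X] →ₗ[ℂ] ℂ} {p : ℕ → ℂ[X]}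

lemma natDegree_eq (hp : IsOPS u p) (n : ℕ) : (p n).natDegree = n :=
  natDegree_eq_of_degree_eq_some (hp.1 n)

lemma coeff_ne_zero (hp : IsOPS u p) (n : ℕ) : (p n).coeff n ≠ 0 :=
  coeff_ne_zero_of_eq_degree (hp.1 n)

lemma degree_sub_smul_lt (hp : IsOPS u p) {n : ℕ} {f : ℂ[X]} (hf : f.degree < (n + 1 : ℕ)) :
    (f - (f.coeff n / (p n).coeff n) • p n).degree < n := by
  rw [degree_lt_iff_coeff_zero]
  intro m hm
  rw [coeff_sub, coeff_smul, smul_eq_mul]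
  rcases hm.eq_or_lt with rfl | hm
  · rw [div_mul_cancel₀ _ (hp.coeff_ne_zero n), sub_self]
  · have hpm : (p n).coeff m = 0 :=
      coeff_eq_zero_of_natDegree_lt (by rw [hp.natDegree_eq]; exact hm)
    rw [(degree_lt_iff_coeff_zero _ _).1 hf m hm, hpm, mul_zero, sub_zero]

lemma mem_span (hp : IsOPS u p) (n : ℕ) :
    ∀ f : ℂ[X], f.degree < n → f ∈ Submodule.span ℂ (p '' Set.Iio n) := by
  induction n with
  | zero =>
    intro f hf
    have : f = 0 := by
      rw [← degree_eq_bot, ← Nat.WithBot.lt_zero_iff]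
      exact_mod_cast hf
    rw [this]
    exact Submodule.zero_mem _
  | succ n ih =>
    intro f hf
    have hsub : p '' Set.Iio n ⊆ p '' Set.Iio (n + 1) :=
      Set.image_mono (Set.Iio_subset_Iio n.le_succ)
    have hlt := hp.degree_sub_smul_lt hf
    have h₁ := Submodule.span_mono hsub (ih _ hlt)
    have h₂ : (f.coeff n / (p n).coeff n) • p n ∈ Submodule.span ℂ (p '' Set.Iio (n + 1)) :=
      Submodule.smul_mem _ _ (Submodule.subset_span ⟨n, Nat.lt_succ_self n, rfl⟩)
    simpa using Submodule.add_mem _ h₁ h₂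

lemma ext (hp : IsOPS u p) {M : Type*} [AddCommGroup M] [Module ℂ M] {F G : ℂ[X] →ₗ[ℂ] M}
    (h : ∀ n, F (p n) = G (p n)) (f : ℂ[X]) : F f = G f := by
  have hf : f ∈ Submodule.span ℂ (p '' Set.Iio (f.natDegree + 1)) :=
    hp.mem_span _ f (degree_lt_iff_coeff_zero _ _ |>.2 fun m hm =>
      coeff_eq_zero_of_natDegree_lt hm)
  refine LinearMap.eqOn_span (f := F) (g := G) ?_ hf
  rintro _ ⟨n, -, rfl⟩
  exact h n

lemma apply_mul_eq_zero (hp : IsOPS u p) {n : ℕ} {f : ℂ[X]} (hf : f.degree < n) :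
    u (p n * f) = 0 := by
  have : f ∈ LinearMap.ker (u ∘ₗ LinearMap.mulLeft ℂ (p n)) := by
    refine (Submodule.span_le.2 ?_) (hp.mem_span n f hf)
    rintro _ ⟨k, hk, rfl⟩
    exact hp.2.1 n k (ne_of_gt hk)
  simpa using this

/-- Modulo polynomials of lower degree, which `p n` annihilates, `f` is a nonzero multiple of `p n`.
-/
lemma apply_mul_ne_zero (hp : IsOPS u p) {n : ℕ} {f : ℂ[X]} (hf : f.natDegree ≤ n)
    (hc : f.coeff n ≠ 0) : u (p n * f) ≠ 0 := by
  have hlt := hp.degree_sub_smul_lt (n := n) (f := f) (degree_lt_iff_coeff_zero _ _ |>.2 fun m hm =>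
    coeff_eq_zero_of_natDegree_lt (hf.trans_lt hm))
  have h := hp.apply_mul_eq_zero hlt
  rw [mul_sub, map_sub, mul_smul_comm, map_smul, sub_eq_zero, smul_eq_mul] at h
  rw [h]
  exact mul_ne_zero (div_ne_zero hc (hp.coeff_ne_zero n)) (hp.2.2 n)

/-- The functional of an orthogonal polynomial sequence is regular. -/
lemma eq_zero_of_forall (hp : IsOPS u p) {f : ℂ[X]} (h : ∀ g, u (g * f) = 0) : f = 0 := by
  by_contra hf
  exact hp.apply_mul_ne_zero le_rfl (by simpa using hf) (h (p f.natDegree))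

lemma apply_one_ne_zero (hp : IsOPS u p) : u 1 ≠ 0 := by
  have h := hp.2.2 0
  rw [eq_C_of_natDegree_eq_zero (hp.natDegree_eq 0), ← C_mul, ← mul_one (C _), ← smul_eq_C_mul,
    map_smul] at h
  exact (smul_ne_zero_iff.1 h).2

/-- A functional vanishing on all `p n` with `n > N` is `u` multiplied by a polynomial of degree at
most `N`. -/
lemma exists_mul_eq (hp : IsOPS u p) (F : ℂ[X] →ₗ[ℂ] ℂ) (N : ℕ) (hF : ∀ n, N < n → F (p n) = 0) :
    ∃ χ : ℂ[X], χ.natDegree ≤ N ∧ ∀ f, F f = u (χ * f) := by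
  -- The Fourier expansion of `F` in the `p k`, finite by hypothesis.
  let χ : ℂ[X] := ∑ k ∈ Finset.range (N + 1), (F (p k) / u (p k * p k)) • p k
  refine ⟨χ, natDegree_sum_le_of_forall_le _ _ fun k hk => (natDegree_smul_le _ _).trans ?_, ?_⟩
  · rw [hp.natDegree_eq]
    have := Finset.mem_range.1 hk
    omega
  · refine fun f => hp.ext (F := F) (G := u ∘ₗ LinearMap.mulLeft ℂ χ) (fun n => ?_) f
    simp only [χ, LinearMap.comp_apply, LinearMap.mulLeft_apply, Finset.sum_mul, map_sum,
      smul_mul_assoc, map_smul, smul_eq_mul]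
    by_cases hn : N < n
    · rw [hF n hn, eq_comm]
      refine Finset.sum_eq_zero fun k hk => ?_
      have := Finset.mem_range.1 hk
      rw [hp.2.1 k n (by omega), mul_zero]
    · rw [Finset.sum_eq_single_of_mem n (Finset.mem_range.2 (by omega)) fun k _ hk => by
        rw [hp.2.1 k n hk, mul_zero], div_mul_cancel₀ _ (hp.2.2 n)]

end IsOPS

/-! ### The Pearson operator and the functional of the differences -/

/-- The operator `φ D + ψ S`. -/
def pearsonOp (r c ω : ℂ) (φ ψ : ℂ[X]) : ℂ[X] →ₗ[ℂ] ℂ[X] :=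
  LinearMap.mulLeft ℂ φ ∘ₗ diffOp r c ω + LinearMap.mulLeft ℂ ψ ∘ₗ meanOp r c ω

/-- The operator `φ S + U₂ ψ D`. -/
def dualPearsonOp (r c ω : ℂ) (φ ψ : ℂ[X]) : ℂ[X] →ₗ[ℂ] ℂ[X] :=
  LinearMap.mulLeft ℂ φ ∘ₗ meanOp r c ω + LinearMap.mulLeft ℂ (polyU₂ r c ω * ψ) ∘ₗ diffOp r c ω

/-- The operator `R ↦ S R (α φ + U₁ ψ) + D R (U₁ φ + α U₂ ψ)`. -/
def shiftOp (r c ω : ℂ) (φ ψ : ℂ[X]) : ℂ[X] →ₗ[ℂ] ℂ[X] :=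
  LinearMap.mulLeft ℂ (C ((r + r⁻¹) / 2) * φ + polyU₁ r c * ψ) ∘ₗ meanOp r c ω +
    LinearMap.mulLeft ℂ (polyU₁ r c * φ + C ((r + r⁻¹) / 2) * polyU₂ r c ω * ψ) ∘ₗ diffOp r c ω

/-- The operator `α S + U₁ D`. -/
def raiseOp (r c ω : ℂ) : ℂ[X] →ₗ[ℂ] ℂ[X] :=
  LinearMap.mulLeft ℂ (C ((r + r⁻¹) / 2)) ∘ₗ meanOp r c ω +
    LinearMap.mulLeft ℂ (polyU₁ r c) ∘ₗ diffOp r c ω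

section Operators

variable (r c ω : ℂ) (φ ψ f : ℂ[X])

lemma pearsonOp_apply : pearsonOp r c ω φ ψ f = φ * diffOp r c ω f + ψ * meanOp r c ω f := rfl

lemma dualPearsonOp_apply : dualPearsonOp r c ω φ ψ f =
    φ * meanOp r c ω f + polyU₂ r c ω * ψ * diffOp r c ω f := rfl

lemma shiftOp_apply : shiftOp r c ω φ ψ f =
    (C ((r + r⁻¹) / 2) * φ + polyU₁ r c * ψ) * meanOp r c ω f +
    (polyU₁ r c * φ + C ((r + r⁻¹) / 2) * polyU₂ r c ω * ψ) * diffOp r c ω f := rfl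

lemma raiseOp_apply : raiseOp r c ω f =
    C ((r + r⁻¹) / 2) * meanOp r c ω f + polyU₁ r c * diffOp r c ω f := rfl

end Operators

/-- A linear operator lowering degrees by exactly `j` is surjective. -/
lemma surjective_of_coeff_ne_zero (T : ℂ[X] →ₗ[ℂ] ℂ[X]) (t : ℕ → ℂ) (j : ℕ) (ht : ∀ n, t n ≠ 0)
    (hT : ∀ (P : ℂ[X]) n, P.natDegree ≤ n + j →
      (T P).natDegree ≤ n ∧ (T P).coeff n = t n * P.coeff (n + j)) :
    Function.Surjective T := by
  have key : ∀ n (g : ℂ[X]), g.degree < (n : ℕ) → ∃ f, T f = g := by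
    intro n
    induction n with
    | zero =>
      intro g hg
      refine ⟨0, ?_⟩
      rw [map_zero, eq_comm, ← degree_eq_bot, ← Nat.WithBot.lt_zero_iff]
      exact_mod_cast hg
    | succ n ih =>
      intro g hg
      obtain ⟨h₁, h₂⟩ := hT (monomial (n + j) (g.coeff n / t n)) n (natDegree_monomial_le _)
      obtain ⟨f, hf⟩ := ih (g - T (monomial (n + j) (g.coeff n / t n))) (by
        rw [degree_lt_iff_coeff_zero]
        intro m hm
        rcases hm.eq_or_lt with rfl | hm
        · rw [coeff_sub, h₂, coeff_monomial_same, mul_div_cancel₀ _ (ht n), sub_self]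
        · rw [coeff_sub, (degree_lt_iff_coeff_zero _ _).1 hg m hm,
            coeff_eq_zero_of_natDegree_lt (h₁.trans_lt hm), sub_zero])
      exact ⟨f + monomial (n + j) (g.coeff n / t n), by rw [map_add, hf, sub_add_cancel]⟩
  exact fun g => key (g.natDegree + 1) g (degree_lt_iff_coeff_zero _ _ |>.2 fun m hm =>
      coeff_eq_zero_of_natDegree_lt hm)

/-! ### Surjectivity, degrees and summation by parts -/

namespace IsQuadraticLattice

variable {x : ℂ → ℂ} {r c ω : ℂ}

lemma diffOp_surjective (hx : IsQuadraticLattice x r c ω) :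
    Function.Surjective (diffOp r c ω) :=
  surjective_of_coeff_ne_zero _ (fun n => diffCoeff r (n + 1)) 1
    (diffCoeff_succ_ne_zero hx.ne_zero hx.pow_ne_one hx.sub_inv_ne_zero)
    fun _ _ hP => diffOp_natDegree_coeff hx.ne_zero hx.sub_inv_ne_zero c ω hP

/-- By the addition formula, the leading coefficient is multiplied by `meanCoeff r (n + 1)`, which
is nonzero. -/
lemma raiseOp_surjective (hx : IsQuadraticLattice x r c ω) :
    Function.Surjective (raiseOp r c ω) := by
  refine surjective_of_coeff_ne_zero _ (fun n => meanCoeff r (n + 1)) 0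
    (fun n => meanCoeff_ne_zero hx.ne_zero hx.pow_ne_one _) fun P n hP => ?_
  have hS := meanOp_natDegree_coeff hx.ne_zero hx.sub_inv_ne_zero c ω hP
  have hD := X_mul_diffOp_natDegree_coeff hx.ne_zero hx.sub_inv_ne_zero c ω hP
  have hα := And.intro (natDegree_C ((r + r⁻¹) / 2)).le (coeff_C_zero (a := (r + r⁻¹) / 2))
  have h₁ := mul_natDegree_coeff hα hS
  have h₂ := mul_natDegree_coeff ⟨natDegree_polyU₁_le r c, coeff_polyU₁ r c⟩ hD
  rw [mul_left_comm, add_comm 1] at h₂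
  rw [zero_add] at h₁
  have h := add_natDegree_coeff h₁ (of_X_mul_natDegree_coeff h₂)
  rw [raiseOp_apply, meanCoeff_succ hx.ne_zero]
  refine ⟨h.1, h.2.trans ?_⟩
  simp only [add_zero]
  ring

lemma pearsonOp_natDegree_coeff (hx : IsQuadraticLattice x r c ω) {φ ψ Q : ℂ[X]} {n : ℕ}
    (hφ : φ.natDegree ≤ 2) (hψ : ψ.natDegree ≤ 1) (hQ : Q.natDegree ≤ n) :
    (pearsonOp r c ω φ ψ Q).natDegree ≤ n + 1 ∧ (pearsonOp r c ω φ ψ Q).coeff (n + 1) =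
      (φ.coeff 2 * diffCoeff r n + ψ.coeff 1 * meanCoeff r n) * Q.coeff n := by
  have hS := meanOp_natDegree_coeff hx.ne_zero hx.sub_inv_ne_zero c ω hQ
  have hD := X_mul_diffOp_natDegree_coeff hx.ne_zero hx.sub_inv_ne_zero c ω hQ
  have h₁ := mul_natDegree_coeff ⟨hφ, rfl⟩ hD
  have h₂ := mul_natDegree_coeff ⟨hψ, rfl⟩ hS
  rw [mul_left_comm, show 2 + n = n + 1 + 1 by ring] at h₁
  rw [add_comm 1] at h₂
  have h := add_natDegree_coeff (of_X_mul_natDegree_coeff h₁) h₂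
  rw [pearsonOp_apply]
  exact ⟨h.1, h.2.trans (by ring)⟩

/-- Arranged so that only `raiseOp R * dualPearsonOp Q` survives when `pearsonOp Q = 0`. -/
lemma shiftOp_mul (hx : IsQuadraticLattice x r c ω) (φ ψ R Q : ℂ[X]) :
    shiftOp r c ω φ ψ (R * Q) = raiseOp r c ω R * dualPearsonOp r c ω φ ψ Q +
      (polyU₁ r c * meanOp r c ω R + C ((r + r⁻¹) / 2) * polyU₂ r c ω * diffOp r c ω R) *
        pearsonOp r c ω φ ψ Q := by
  rw [shiftOp_apply, raiseOp_apply, dualPearsonOp_apply, pearsonOp_apply, hx.meanOp_mul,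
    hx.diffOp_mul]
  ring

/-- Summation by parts. -/
lemma shiftOp_diffOp_mul (hx : IsQuadraticLattice x r c ω) (φ ψ f Q : ℂ[X]) :
    shiftOp r c ω φ ψ (diffOp r c ω f * Q) + f * pearsonOp r c ω φ ψ Q =
      pearsonOp r c ω φ ψ (meanOp r c ω f * Q) := by
  rw [hx.shiftOp_mul, raiseOp_apply, dualPearsonOp_apply, pearsonOp_apply, pearsonOp_apply,
    hx.meanOp_mul, hx.diffOp_mul, hx.diffOp_meanOp, hx.meanOp_meanOp]
  ring

lemma functionalPearson_iff (hx : IsQuadraticLattice x r c ω) (u : ℂ[X] →ₗ[ℂ] ℂ) (φ ψ : ℂ[X]) :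
    FunctionalPearson x u φ ψ ↔ ∀ P, u (pearsonOp r c ω φ ψ P) = 0 := by
  simp [FunctionalPearson, hx.isDividedDifference_iff, hx.isMean_iff, pearsonOp_apply]

lemma differencesAreOPS_iff (hx : IsQuadraticLattice x r c ω) (p : ℕ → ℂ[X]) :
    DifferencesAreOPS x p ↔ ∃ v, IsOPS v fun n => diffOp r c ω (p (n + 1)) := by
  simp only [DifferencesAreOPS, hx.isDividedDifference_iff]
  constructor
  · rintro ⟨d, hd, v, hv⟩
    exact ⟨v, (funext hd : d = _) ▸ hv⟩
  · rintro ⟨v, hv⟩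
    exact ⟨_, fun _ => rfl, v, hv⟩

/-! ### The Pearson equation gives orthogonal differences -/

variable {u : ℂ[X] →ₗ[ℂ] ℂ} {p : ℕ → ℂ[X]} {φ ψ : ℂ[X]}

lemma apply_shiftOp (hx : IsQuadraticLattice x r c ω)
    (hu : ∀ P, u (pearsonOp r c ω φ ψ P) = 0) (f Q : ℂ[X]) :
    u (shiftOp r c ω φ ψ (diffOp r c ω f * Q)) = -u (f * pearsonOp r c ω φ ψ Q) := by
  rw [eq_neg_iff_add_eq_zero, ← map_add, hx.shiftOp_diffOp_mul, hu]

/-- Eliminating `φ` leaves `ψ · ((SQ)² - U₂ (DQ)²) = 0`. At `x(s)` the second factor is `Q(x(s +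
1/2)) Q(x(s - 1/2))`; its coefficient in degree `2 deg Q` is the square of the leading coefficient
of `Q`, because `cosh² - sinh² = 1`. -/
lemma eq_zero_of_pearsonOp_eq_zero (hx : IsQuadraticLattice x r c ω) {Q : ℂ[X]} (hQ : Q ≠ 0)
    (h₁ : pearsonOp r c ω φ ψ Q = 0) (h₂ : dualPearsonOp r c ω φ ψ Q = 0) : ψ = 0 := by
  have h₃ : ψ * (meanOp r c ω Q ^ 2 - polyU₂ r c ω * diffOp r c ω Q ^ 2) = 0 := by
    rw [pearsonOp_apply] at h₁
    rw [dualPearsonOp_apply] at h₂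
    linear_combination meanOp r c ω Q * h₁ - diffOp r c ω Q * h₂
  refine (mul_eq_zero.1 h₃).resolve_right fun h => hQ ?_
  have hS := meanOp_natDegree_coeff hx.ne_zero hx.sub_inv_ne_zero c ω (le_refl Q.natDegree)
  have hD := X_mul_diffOp_natDegree_coeff hx.ne_zero hx.sub_inv_ne_zero c ω (le_refl Q.natDegree)
  have hS₂ := mul_natDegree_coeff hS hS
  have hD₂ := mul_natDegree_coeff ⟨natDegree_polyU₂_le r c ω, coeff_polyU₂ r c ω⟩
    (mul_natDegree_coeff hD hD)
  have h₄ : X * (X * (meanOp r c ω Q * meanOp r c ω Q)) =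
      polyU₂ r c ω * ((X * diffOp r c ω Q) * (X * diffOp r c ω Q)) := by
    linear_combination X ^ 2 * h
  have h₅ := (X_mul_natDegree_coeff (X_mul_natDegree_coeff hS₂)).2
  rw [h₄, show Q.natDegree + Q.natDegree + 1 + 1 = 2 + (Q.natDegree + Q.natDegree) by ring,
    hD₂.2] at h₅
  have h₆ : meanCoeff r Q.natDegree ^ 2 - (((r + r⁻¹) / 2) ^ 2 - 1) * diffCoeff r Q.natDegree ^ 2
      = 1 := by
    have h₀ := hx.ne_zero
    have h₇ : ((r + r⁻¹) / 2) ^ 2 - 1 = (r - r⁻¹) ^ 2 / 4 := by field_simp; ring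
    have h₈ : r ^ Q.natDegree * r⁻¹ ^ Q.natDegree = 1 := by
      rw [← mul_pow, mul_inv_cancel₀ h₀, one_pow]
    have h₉ := hx.sub_inv_ne_zero
    rw [h₇, diffCoeff, meanCoeff]
    generalize r⁻¹ = t at *
    field_simp
    linear_combination 16 * h₈
  have h₁₀ : Q.coeff Q.natDegree ^ 2 = 0 := by
    linear_combination -h₅ - Q.coeff Q.natDegree ^ 2 * h₆
  simpa using h₁₀

/-- Regularity of the functional forces the leading coefficients of `φ D + ψ S` to be nonzero. -/
lemma admissible (hx : IsQuadraticLattice x r c ω) (hp : IsOPS u p) (hφ : φ.natDegree ≤ 2)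
    (hψ : ψ.natDegree = 1) (hu : ∀ P, u (pearsonOp r c ω φ ψ P) = 0) (n : ℕ) :
    φ.coeff 2 * diffCoeff r n + ψ.coeff 1 * meanCoeff r n ≠ 0 := by
  intro h
  set Q := diffOp r c ω (p (n + 1)) with hQ
  have hdeg : ∀ m, (diffOp r c ω (p (m + 1))).natDegree ≤ m ∧
      (diffOp r c ω (p (m + 1))).coeff m = _ := fun m =>
    diffOp_natDegree_coeff hx.ne_zero hx.sub_inv_ne_zero c ω (hp.natDegree_eq (m + 1)).le
  have hQ₀ : Q ≠ 0 := by
    intro h₀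
    have h₁ := (hdeg n).2
    rw [← hQ, h₀, coeff_zero] at h₁
    exact mul_ne_zero (diffCoeff_succ_ne_zero hx.ne_zero hx.pow_ne_one hx.sub_inv_ne_zero n)
      (hp.coeff_ne_zero (n + 1)) h₁.symm
  -- It suffices to take `f = p m`. Constants are killed by `D`.
  have hshift : ∀ f, u (shiftOp r c ω φ ψ (diffOp r c ω f * Q)) = 0 := by
    refine fun f => hp.ext
      (F := u ∘ₗ shiftOp r c ω φ ψ ∘ₗ LinearMap.mulRight ℂ Q ∘ₗ diffOp r c ω) (G := 0) ?_ f
    intro m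
    change u (shiftOp r c ω φ ψ (diffOp r c ω (p m) * Q)) = 0
    rcases m with _ | m
    · rw [eq_C_of_natDegree_eq_zero (hp.natDegree_eq 0), ← mul_one (C _), ← smul_eq_C_mul,
        map_smul, diffOp_one]
      simp
    -- For `n ≤ m`, the vanishing coefficient gives `deg LQ ≤ n`, below the index `m + 1`. For `m <
    -- n`, the symmetry of the product lets `p (n + 1)` be the orthogonal factor instead.
    rcases le_or_gt n m with hmn | hmn
    · rw [hx.apply_shiftOp hu, hp.apply_mul_eq_zero, neg_zero]
      have hL := hx.pearsonOp_natDegree_coeff hφ hψ.le (hdeg n).1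
      rw [h, zero_mul] at hL
      rw [degree_lt_iff_coeff_zero]
      intro k hk
      rcases (show n + 1 ≤ k by omega).eq_or_lt with rfl | hk'
      · exact hL.2
      · exact coeff_eq_zero_of_natDegree_lt (hL.1.trans_lt hk')
    · rw [mul_comm, hQ, hx.apply_shiftOp hu, hp.apply_mul_eq_zero, neg_zero]
      have hL := hx.pearsonOp_natDegree_coeff hφ hψ.le (hdeg m).1
      rw [degree_lt_iff_coeff_zero]
      exact fun k hk => coeff_eq_zero_of_natDegree_lt (hL.1.trans_lt (by omega))
  have hL₀ : pearsonOp r c ω φ ψ Q = 0 := hp.eq_zero_of_forall fun f => by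
    rw [← neg_eq_zero, ← hx.apply_shiftOp hu, hshift]
  have hh₀ : dualPearsonOp r c ω φ ψ Q = 0 := hp.eq_zero_of_forall fun g => by
    -- Every `g` is `raiseOp (D f)` for some `f`, so regularity of `u` applies once more.
    obtain ⟨R, rfl⟩ := hx.raiseOp_surjective g
    obtain ⟨f, rfl⟩ := hx.diffOp_surjective R
    have := hshift f
    rwa [hx.shiftOp_mul, hL₀, mul_zero, add_zero] at this
  rw [hx.eq_zero_of_pearsonOp_eq_zero hQ₀ hL₀ hh₀, natDegree_zero] at hψ
  exact zero_ne_one hψ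

lemma isOPS_diffOp (hx : IsQuadraticLattice x r c ω) (hp : IsOPS u p) (hφ : φ.natDegree ≤ 2)
    (hψ : ψ.natDegree = 1) (hu : ∀ P, u (pearsonOp r c ω φ ψ P) = 0) :
    IsOPS (u ∘ₗ shiftOp r c ω φ ψ) fun n => diffOp r c ω (p (n + 1)) := by
  have hdeg : ∀ m, (diffOp r c ω (p (m + 1))).natDegree ≤ m ∧
      (diffOp r c ω (p (m + 1))).coeff m = _ := fun m =>
    diffOp_natDegree_coeff hx.ne_zero hx.sub_inv_ne_zero c ω (hp.natDegree_eq (m + 1)).le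
  have hne : ∀ m, (diffOp r c ω (p (m + 1))).coeff m ≠ 0 := fun m => by
    rw [(hdeg m).2]
    exact mul_ne_zero (diffCoeff_succ_ne_zero hx.ne_zero hx.pow_ne_one hx.sub_inv_ne_zero m)
      (hp.coeff_ne_zero (m + 1))
  have hlt : ∀ m n, m < n →
      u (shiftOp r c ω φ ψ (diffOp r c ω (p (n + 1)) * diffOp r c ω (p (m + 1)))) = 0 := by
    intro m n hmn
    rw [hx.apply_shiftOp hu, hp.apply_mul_eq_zero, neg_zero]
    rw [degree_lt_iff_coeff_zero]
    exact fun k hk => coeff_eq_zero_of_natDegree_lt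
      ((hx.pearsonOp_natDegree_coeff hφ hψ.le (hdeg m).1).1.trans_lt (by omega))
  refine ⟨fun n => ?_, fun m n hmn => ?_, fun n => ?_⟩
  · exact le_antisymm (natDegree_le_iff_degree_le.1 (hdeg n).1) (le_degree_of_ne_zero (hne n))
  · rcases lt_or_gt_of_ne hmn with h | h
    · rw [mul_comm]
      exact hlt m n h
    · exact hlt n m h
  · have hL := hx.pearsonOp_natDegree_coeff hφ hψ.le (hdeg n).1
    rw [LinearMap.comp_apply, hx.apply_shiftOp hu]
    refine neg_ne_zero.2 (hp.apply_mul_ne_zero hL.1 ?_)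
    rw [hL.2]
    exact mul_ne_zero (hx.admissible hp hφ hψ hu n) (hne n)

/-! ### Orthogonal differences give the Pearson equation -/

lemma exists_pearson (hx : IsQuadraticLattice x r c ω) (hp : IsOPS u p) {v : ℂ[X] →ₗ[ℂ] ℂ}
    (hv : IsOPS v fun n => diffOp r c ω (p (n + 1))) :
    ∃ φ ψ : ℂ[X], φ.natDegree ≤ 2 ∧ ψ.natDegree = 1 ∧ ∀ P, u (pearsonOp r c ω φ ψ P) = 0 := by
  obtain ⟨η, hη, hηu⟩ := hp.exists_mul_eq (v ∘ₗ diffOp r c ω) 1 fun n hn => by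
    obtain ⟨m, rfl⟩ : ∃ m, n = m + 1 := ⟨n - 1, by omega⟩
    have := hv.apply_mul_eq_zero (n := m) (f := 1) (by
      rw [degree_one]; exact_mod_cast (show 0 < m by omega))
    simpa using this
  obtain ⟨χ, hχ, hχu⟩ := hp.exists_mul_eq (v ∘ₗ LinearMap.mulRight ℂ X ∘ₗ diffOp r c ω) 2
    fun n hn => by
      obtain ⟨m, rfl⟩ : ∃ m, n = m + 1 := ⟨n - 1, by omega⟩
      exact hv.apply_mul_eq_zero (n := m) (f := X) (by
        rw [degree_X]; exact_mod_cast (show 1 < m by omega))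
  simp only [LinearMap.comp_apply, LinearMap.mulRight_apply] at hηu hχu
  have hη₁ : η.natDegree = 1 := by
    -- If `η` were constant, `v(D1) = 0` and `u 1 ≠ 0` would force `η = 0`; then `v 1 = v(DX) = 0`,
    -- contradicting the regularity of `v`.
    refine le_antisymm hη (Nat.one_le_iff_ne_zero.2 fun h₀ => ?_)
    have h₁ := hηu 1
    rw [diffOp_one, map_zero, mul_one, eq_C_of_natDegree_eq_zero h₀, ← mul_one (C _),
      ← smul_eq_C_mul, map_smul, eq_comm] at h₁
    have h₂ := (smul_eq_zero.1 h₁).resolve_right hp.apply_one_ne_zero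
    have h₃ := hηu X
    rw [diffOp_X, eq_C_of_natDegree_eq_zero h₀, h₂, C_0, zero_mul, map_zero] at h₃
    exact hv.apply_one_ne_zero h₃
  refine ⟨η * meanX r c - χ, -η, ?_, by rw [natDegree_neg, hη₁], fun P => ?_⟩
  · exact natDegree_sub_le_of_le (natDegree_mul_le_of_le hη (natDegree_meanX_le r c)) hχ
  · have h : pearsonOp r c ω (η * meanX r c - χ) (-η) P =
        η * (meanX r c * diffOp r c ω P) - χ * diffOp r c ω P - η * meanOp r c ω P := by
      rw [pearsonOp_apply]; ring
    rw [h, map_sub, map_sub, ← hηu, ← hηu, ← hχu, ← map_sub, ← map_sub, hx.diffOp_mul,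
      hx.meanOp_meanX, hx.diffOp_meanX, hx.diffOp_meanOp]
    convert map_zero v using 2
    ring

theorem isQClassicalOPS_iff (hx : IsQuadraticLattice x r c ω) (hp : IsOPS u p) :
    IsQClassicalOPS x u p ↔ DifferencesAreOPS x p := by
  rw [hx.differencesAreOPS_iff]
  simp only [IsQClassicalOPS, hx.functionalPearson_iff]
  constructor
  · rintro ⟨-, φ, ψ, hφ, hψ, hu⟩
    exact ⟨_, hx.isOPS_diffOp hp hφ hψ hu⟩
  · rintro ⟨v, hv⟩
    exact ⟨hp, hx.exists_pearson hp hv⟩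

end IsQuadraticLattice

/-! ### Sums over intervals of integers -/

/-- Summation of differences over an interval of integers. -/
lemma tendsto_sum_Ico_indicator_sub {I : Set ℤ} (hI : I.OrdConnected) {F : ℤ → ℂ}
    (hF : VanishesAtEnds I F) :
    Tendsto (fun N : ℤ × ℤ => ∑ k ∈ Finset.Ico N.1 N.2, I.indicator (fun k => F (k + 1) - F k) k)
      (atBot ×ˢ atTop) (𝓝 0) := by
  classical
  obtain ⟨hmin, hmax, hbot, htop⟩ := hF
  -- `F` cut off outside `I ∪ (I + 1)`. The end conditions at the least point and one past the
  -- greatest make the indicator sum telescope over all of `ℤ`.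
  set H : ℤ → ℂ := fun k => if k ∈ I ∨ k - 1 ∈ I then F k else 0 with hH
  have hdiff : ∀ k, I.indicator (fun k => F (k + 1) - F k) k = H (k + 1) - H k := by
    intro k
    by_cases hk : k ∈ I
    · simp [hH, hk]
    have h₁ : H (k + 1) = 0 := by
      by_cases hk₁ : k + 1 ∈ I
      · simp only [hH, hk₁, true_or, if_true]
        refine hmin _ ⟨hk₁, fun j hj => ?_⟩
        by_contra! hlt
        exact hk (hI.out hj hk₁ ⟨by omega, by omega⟩)
      · simp [hH, hk, hk₁]
    have h₂ : H k = 0 := by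
      by_cases hk₁ : k - 1 ∈ I
      · simp only [hH, hk₁, or_true, if_true]
        have := hmax (k - 1) ⟨hk₁, fun j hj => by
          by_contra! hlt
          exact hk (hI.out hk₁ hj ⟨by omega, by omega⟩)⟩
        rwa [sub_add_cancel] at this
      · simp [hH, hk, hk₁]
    rw [Set.indicator_of_notMem hk, h₁, h₂, sub_zero]
  have hle : ∀ k, ‖H k‖ ≤ ‖F k‖ := by
    intro k
    by_cases hk : k ∈ I ∨ k - 1 ∈ I <;> simp [hH, hk]
  have hHtop : Tendsto H atTop (𝓝 0) := by
    by_cases hb : BddAbove I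
    · obtain ⟨B, hB⟩ := hb
      refine tendsto_const_nhds.congr' ?_
      filter_upwards [eventually_gt_atTop (B + 1)] with k hk
      have h₁ : k ∉ I := fun h => by have := hB h; omega
      have h₂ : k - 1 ∉ I := fun h => by have := hB h; omega
      simp [hH, h₁, h₂]
    · exact squeeze_zero_norm hle (by simpa using (htop hb).norm)
  have hHbot : Tendsto H atBot (𝓝 0) := by
    by_cases hb : BddBelow I
    · obtain ⟨B, hB⟩ := hb
      refine tendsto_const_nhds.congr' ?_
      filter_upwards [eventually_lt_atBot B] with k hk
      have h₁ : k ∉ I := fun h => by have := hB h; omega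
      have h₂ : k - 1 ∉ I := fun h => by have := hB h; omega
      simp [hH, h₁, h₂]
    · exact squeeze_zero_norm hle (by simpa using (hbot hb).norm)
  have hsum : ∀ a b : ℤ, a ≤ b → ∑ k ∈ Finset.Ico a b, (H (k + 1) - H k) = H b - H a := by
    intro a b hab
    induction b, hab using Int.leInduction with
    | base => simp
    | succ b hab ih =>
      rw [← Finset.insert_Ico_right_eq_Ico_add_one hab, Finset.sum_insert (by simp), ih]
      ring
  have hlim : Tendsto (fun N : ℤ × ℤ => H N.2 - H N.1) (atBot ×ˢ atTop) (𝓝 0) := by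
    simpa using (hHtop.comp tendsto_snd).sub (hHbot.comp tendsto_fst)
  refine hlim.congr' ?_
  filter_upwards [(eventually_le_atBot (0 : ℤ)).prod_mk (eventually_ge_atTop (0 : ℤ))] with N hN
  rw [← hsum _ _ (hN.1.trans hN.2)]
  exact Finset.sum_congr rfl fun k _ => (hdiff k).symm

lemma tendsto_sum_Ico_of_hasSum {I : Set ℤ} {f : ℤ → ℂ} {a : ℂ}
    (h : HasSum (fun k : I => f k) a) :
    Tendsto (fun N : ℤ × ℤ => ∑ k ∈ Finset.Ico N.1 N.2, I.indicator f k)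
      (atBot ×ˢ atTop) (𝓝 a) :=
  (hasSum_subtype_iff_indicator.1 h).comp Finset.tendsto_Ico_atBot_prod_atTop

/-! ### Boundary conditions -/

lemma VanishesAtEnds.add {I : Set ℤ} {F G : ℤ → ℂ} (hF : VanishesAtEnds I F)
    (hG : VanishesAtEnds I G) : VanishesAtEnds I fun k => F k + G k := by
  refine ⟨fun a ha => ?_, fun a ha => ?_, fun h => ?_, fun h => ?_⟩
  · beta_reduce
    rw [hF.1 a ha, hG.1 a ha, add_zero]
  · beta_reduce
    rw [hF.2.1 a ha, hG.2.1 a ha, add_zero]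
  · simpa using (hF.2.2.1 h).add (hG.2.2.1 h)
  · simpa using (hF.2.2.2 h).add (hG.2.2.2 h)

lemma VanishesAtEnds.const_mul {I : Set ℤ} {F : ℤ → ℂ} (hF : VanishesAtEnds I F) (e : ℂ) :
    VanishesAtEnds I fun k => e * F k := by
  refine ⟨fun a ha => ?_, fun a ha => ?_, fun h => ?_, fun h => ?_⟩
  · beta_reduce
    rw [hF.1 a ha, mul_zero]
  · beta_reduce
    rw [hF.2.1 a ha, mul_zero]
  · simpa using (hF.2.2.1 h).const_mul e
  · simpa using (hF.2.2.2 h).const_mul e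

namespace BoundaryCondition

variable {x : ℂ → ℂ} {s₀ : ℂ} {I : Set ℤ} {f g : ℂ → ℂ}

lemma vanishesAtEnds (hf : BoundaryCondition x s₀ I f) :
    VanishesAtEnds I fun k => f (s₀ + (k : ℤ)) := by
  simpa using hf 0 0

lemma add (hf : BoundaryCondition x s₀ I f) (hg : BoundaryCondition x s₀ I g) :
    BoundaryCondition x s₀ I fun s => f s + g s := fun i j => by
  simpa only [mul_add] using (hf i j).add (hg i j)

lemma const_mul (hf : BoundaryCondition x s₀ I f) (e : ℂ) :
    BoundaryCondition x s₀ I fun s => e * f s := fun i j => by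
  simpa only [mul_left_comm e] using (hf i j).const_mul e

lemma lattice_pow_mul (hf : BoundaryCondition x s₀ I f) (n : ℕ) :
    BoundaryCondition x s₀ I fun s => x s ^ n * f s := fun i j => by
  convert hf (i + n) j using 2
  ring

lemma shifted_pow_mul (hf : BoundaryCondition x s₀ I f) (n : ℕ) :
    BoundaryCondition x s₀ I fun s => x (s - 1 / 2) ^ n * f s := fun i j => by
  convert hf i (j + n) using 2
  ring

lemma eval_lattice_mul (hf : BoundaryCondition x s₀ I f) (P : ℂ[X]) :
    BoundaryCondition x s₀ I fun s => P.eval (x s) * f s := by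
  induction P using Polynomial.induction_on' with
  | add p q hp hq => simpa only [eval_add, add_mul] using hp.add hq
  | monomial n a => simpa only [eval_monomial, mul_assoc] using (hf.lattice_pow_mul n).const_mul a

lemma eval_shifted_mul (hf : BoundaryCondition x s₀ I f) (P : ℂ[X]) :
    BoundaryCondition x s₀ I fun s => P.eval (x (s - 1 / 2)) * f s := by
  induction P using Polynomial.induction_on' with
  | add p q hp hq => simpa only [eval_add, add_mul] using hp.add hq
  | monomial n a => simpa only [eval_monomial, mul_assoc] using (hf.shifted_pow_mul n).const_mul a

/-- Replacing `x(s + 1/2)` by `2·SX - x(s - 1/2)` gives `σ(s) = (φ - ψ·SX)(x(s)) + ψ(x(s))·x₋₁(s)`,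
a polynomial in `x` and `x₋₁`. -/
lemma sigma_mul {r c ω : ℂ} (hx : IsQuadraticLattice x r c ω) (hf : BoundaryCondition x s₀ I f)
    (φ ψ : ℂ[X]) : BoundaryCondition x s₀ I fun s => sigma x φ ψ s * f s := by
  have h := (hf.eval_lattice_mul (φ - ψ * meanX r c)).add
    ((hf.eval_lattice_mul ψ).eval_shifted_mul X)
  convert h using 2 with s
  rw [sigma, nablaX1, eval_sub, eval_mul, hx.eval_meanX, eval_X]
  ring

end BoundaryCondition

/-! ### Functionals given by a weight -/

namespace IsQuadraticLattice

variable {x : ℂ → ℂ} {r c ω : ℂ} {u : ℂ[X] →ₗ[ℂ] ℂ} {s₀ : ℂ} {I : Set ℤ} {ρ : ℂ → ℂ}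
  {φ ψ : ℂ[X]}

/-- `(φ D P + ψ S P) ∇x₁` in terms of `σ` and the values of `P` at `x₁(s)` and `x₁(s - 1)`. -/
lemma eval_pearsonOp_mul_nabla (hx : IsQuadraticLattice x r c ω) (P : ℂ[X]) (s : ℂ) :
    (pearsonOp r c ω φ ψ P).eval (x s) * nablaX1 x s =
      P.eval (x (s + 1 / 2)) * (sigma x φ ψ s + ψ.eval (x s) * nablaX1 x s) -
      P.eval (x (s - 1 / 2)) * sigma x φ ψ s := by
  have h := hx.eval_diffOp P s
  simp only [pearsonOp_apply, eval_add, eval_mul, hx.eval_meanOp, sigma]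
  linear_combination φ.eval (x s) * h

/-- Summation by parts for the weight: the defect of the pointwise Pearson equation, tested against
`P(x₁(s))`, sums to `-⟨u, φ D P + ψ S P⟩`. -/
lemma tendsto_sum_pearson_defect (hx : IsQuadraticLattice x r c ω) (hI : I.OrdConnected)
    (hu : IsRepresentedBy x u s₀ I ρ)
    (hσ : BoundaryCondition x s₀ I fun s => sigma x φ ψ s * ρ s) (P : ℂ[X]) :
    Tendsto (fun N : ℤ × ℤ => ∑ k ∈ Finset.Ico N.1 N.2, I.indicator (fun k : ℤ =>
        (sigma x φ ψ (s₀ + k + 1) * ρ (s₀ + k + 1) - sigma x φ ψ (s₀ + k) * ρ (s₀ + k) -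
          ψ.eval (x (s₀ + k)) * ρ (s₀ + k) * nablaX1 x (s₀ + k)) *
        P.eval (x (s₀ + k + 1 / 2))) k)
      (atBot ×ˢ atTop) (𝓝 (-u (pearsonOp r c ω φ ψ P))) := by
  -- The telescoping function is `P(x(s - 1/2)) σ(s) ρ(s)`. Its differences are only summed along
  -- intervals, hence the conditional sums in `IsDeterminate`.
  have h₁ := tendsto_sum_Ico_indicator_sub hI (hσ.eval_shifted_mul P).vanishesAtEnds
  have h₂ := tendsto_sum_Ico_of_hasSum
    (f := fun k : ℤ => (pearsonOp r c ω φ ψ P).eval (x (s₀ + k)) * ρ (s₀ + k) * nablaX1 x (s₀ + k))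
    (hu (pearsonOp r c ω φ ψ P))
  have h₃ := h₁.sub h₂
  rw [zero_sub] at h₃
  refine h₃.congr fun N => ?_
  rw [← Finset.sum_sub_distrib]
  refine Finset.sum_congr rfl fun k _ => ?_
  by_cases hk : k ∈ I
  swap
  · simp only [Set.indicator_of_notMem hk, sub_zero]
  simp only [Set.indicator_of_mem hk]
  have h := hx.eval_pearsonOp_mul_nabla (φ := φ) (ψ := ψ) P (s₀ + k)
  have e₁ : s₀ + ((k + 1 : ℤ) : ℂ) = s₀ + k + 1 := by push_cast; ring
  have e₂ : s₀ + (k : ℂ) + 1 - 1 / 2 = s₀ + k + 1 / 2 := by ring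
  simp only [e₁, e₂]
  linear_combination -ρ (s₀ + k) * h

lemma apply_pearsonOp_eq_zero (hx : IsQuadraticLattice x r c ω) (hI : I.OrdConnected)
    (hu : IsRepresentedBy x u s₀ I ρ) (hW : WeightPearson x s₀ I ρ φ ψ)
    (hσ : BoundaryCondition x s₀ I fun s => sigma x φ ψ s * ρ s) (P : ℂ[X]) :
    u (pearsonOp r c ω φ ψ P) = 0 := by
  have h := hx.tendsto_sum_pearson_defect hI hu hσ P
  rw [← neg_eq_zero]
  refine tendsto_nhds_unique h (tendsto_const_nhds.congr fun N => ?_)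
  rw [Finset.sum_eq_zero]
  intro k _
  by_cases hk : k ∈ I
  · rw [Set.indicator_of_mem hk, hW k hk, sub_self, zero_mul]
  · rw [Set.indicator_of_notMem hk]

lemma weightPearson_of_isDeterminate (hx : IsQuadraticLattice x r c ω) (hI : I.OrdConnected)
    (hu : IsRepresentedBy x u s₀ I ρ) (hdet : IsDeterminate x s₀ I)
    (hσ : BoundaryCondition x s₀ I fun s => sigma x φ ψ s * ρ s)
    (hP : ∀ P, u (pearsonOp r c ω φ ψ P) = 0) : WeightPearson x s₀ I ρ φ ψ := by
  have h := hdet (I.indicator fun k : ℤ =>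
    sigma x φ ψ (s₀ + k + 1) * ρ (s₀ + k + 1) - sigma x φ ψ (s₀ + k) * ρ (s₀ + k) -
      ψ.eval (x (s₀ + k)) * ρ (s₀ + k) * nablaX1 x (s₀ + k))
    (fun k hk => Set.indicator_of_notMem hk _) fun n => by
      have h := hx.tendsto_sum_pearson_defect hI hu hσ (X ^ n)
      rw [hP, neg_zero] at h
      refine h.congr fun N => Finset.sum_congr rfl fun k _ => ?_
      by_cases hk : k ∈ I
      · rw [Set.indicator_of_mem hk, Set.indicator_of_mem hk, eval_pow, eval_X]
      · rw [Set.indicator_of_notMem hk, Set.indicator_of_notMem hk, zero_mul]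
  intro k hk
  have := h k
  rw [Set.indicator_of_mem hk] at this
  exact sub_eq_zero.1 this

end IsQuadraticLattice

end QLattice

end

/-! ### Assembly of the theorem -/

theorem theorem4p3 (q c₁ c₂ c₃ : ℂ) (hq₀ : q ≠ 0) (hq : ∀ n : ℕ, 1 ≤ n → q ^ n ≠ 1)
    (hc : c₁ ≠ 0 ∨ c₂ ≠ 0) (u : ℂ[X] →ₗ[ℂ] ℂ) (p : ℕ → ℂ[X]) (hp : QLattice.IsOPS u p) :
    (QLattice.IsQClassicalOPS (QLattice.lattice q c₁ c₂ c₃) u p ↔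
      QLattice.DifferencesAreOPS (QLattice.lattice q c₁ c₂ c₃) p) ∧
    (∀ (s₀ : ℂ) (I : Set ℤ) (ρ : ℂ → ℂ), I.OrdConnected →
      QLattice.IsRepresentedBy (QLattice.lattice q c₁ c₂ c₃) u s₀ I ρ →
      (∀ φ ψ : ℂ[X], φ.natDegree ≤ 2 → ψ.natDegree = 1 →
        QLattice.WeightPearson (QLattice.lattice q c₁ c₂ c₃) s₀ I ρ φ ψ →
        QLattice.BoundaryCondition (QLattice.lattice q c₁ c₂ c₃) s₀ I
          (fun s => QLattice.sigma (QLattice.lattice q c₁ c₂ c₃) φ ψ s * ρ s) →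
        QLattice.IsQClassicalOPS (QLattice.lattice q c₁ c₂ c₃) u p ∧
          QLattice.DifferencesAreOPS (QLattice.lattice q c₁ c₂ c₃) p) ∧
      (QLattice.BoundaryCondition (QLattice.lattice q c₁ c₂ c₃) s₀ I ρ →
        QLattice.IsDeterminate (QLattice.lattice q c₁ c₂ c₃) s₀ I →
        ((∃ φ ψ : ℂ[X], φ.natDegree ≤ 2 ∧ ψ.natDegree = 1 ∧
            QLattice.WeightPearson (QLattice.lattice q c₁ c₂ c₃) s₀ I ρ φ ψ) ↔
          QLattice.DifferencesAreOPS (QLattice.lattice q c₁ c₂ c₃) p))) := by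
  have hx := QLattice.isQuadraticLattice_lattice c₃ hq₀ hq hc
  -- From here on only the properties in `IsQuadraticLattice` matter.
  generalize QLattice.lattice q c₁ c₂ c₃ = x at *
  have hiff := hx.isQClassicalOPS_iff hp
  refine ⟨hiff, fun s₀ I ρ hI hu => ?_⟩
  have hsuff : ∀ φ ψ : ℂ[X], φ.natDegree ≤ 2 → ψ.natDegree = 1 →
      QLattice.WeightPearson x s₀ I ρ φ ψ →
      QLattice.BoundaryCondition x s₀ I (fun s => QLattice.sigma x φ ψ s * ρ s) →
      QLattice.IsQClassicalOPS x u p := fun φ ψ hφ hψ hW hσ =>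
    ⟨hp, φ, ψ, hφ, hψ, (hx.functionalPearson_iff u φ ψ).2
      (hx.apply_pearsonOp_eq_zero hI hu hW hσ)⟩
  refine ⟨fun φ ψ hφ hψ hW hσ => ?_, fun hρ hdet => ⟨?_, fun hD => ?_⟩⟩
  · exact ⟨hsuff φ ψ hφ hψ hW hσ, hiff.1 (hsuff φ ψ hφ hψ hW hσ)⟩
  · rintro ⟨φ, ψ, hφ, hψ, hW⟩
    exact hiff.1 (hsuff φ ψ hφ hψ hW (hρ.sigma_mul hx φ ψ))
  · obtain ⟨-, φ, ψ, hφ, hψ, hP⟩ := hiff.2 hD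
    exact ⟨φ, ψ, hφ, hψ, hx.weightPearson_of_isDeterminate hI hu hdet (hρ.sigma_mul hx φ ψ)
      ((hx.functionalPearson_iff u φ ψ).1 hP)⟩
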